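/- **Setting.** Let $N=\{1,\dots,n\}$ be a set of players and $m=2^n-1$ the number of nonempty coalitions. Let $B_{\mathcal H}\in\{0,1\}^{m\times n}$ be the matrix whose rows are the characteristic vectors of the nonempty coalitions (the grand coalition last), and $B=\left[B_{\mathcal H}\ \middle|\ \begin{smallmatrix}-I_{m-1}\\0\end{smallmatrix}\right]\in\mathbb R^{m\times(n+m-1)}$. Given $a_{\min},a_{\max}\in\mathbb R^n$, the feasible controls are $U=\{u=(a,s)\in\mathbb R^n\times\mathbb R^{m-1}:\ a_{\min}\le a\le a_{\max},\ s\ge 0\}$. Let $v(t)$, $t\ge0$, be a (jointly measurable) bounded mean ergodic process on a probability space: there are a bounded convex set $\mathcal V\subset\mathbb R^m$ and a probability law such that every $v(t)$ takes values in $\mathcal V$ and has this law, and $\mathbb E[v(t)]=v_{nom}=\lim_{\tau\to\infty}\frac1\tau\int_0^\tau v(s)\,ds$ with probability one, for all $t\ge 0$. Let $\delta>0$, let $B^\dagger$ be a matrix with $BB^\dagger=I$, and let $u_{nom}\in U$ satisfy $Bu_{nom}=v_{nom}$. Assume that the sign-based controller $\hat\phi(\operatorname{sgn}(x))=u_{nom}-\delta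 B^\dagger \operatorname{sgn}(x)$ (componentwise sign, $\operatorname{sgn}0=0$) takes values in $U$. Let $x(t)$, $t\ge 0$, be a state process with $\mathbb E\|x(0)\|^2<\infty$ that solves the closed loop $$\dot x(t)=Bu(t)-v(t),\qquad u(t)=\hat\phi(\operatorname{sgn}(x(t))),$$ in the sense of Filippov: with probability one, $x(t)=x(0)+\int_0^t(Bu(s)-v(s))\,ds$ for all $t\ge 0$, where $u$ is jointly measurable and, for almost every $t$, $u(t)=u_{nom}-\delta B^\dagger\sigma$ for some $\sigma\in\mathbb R^m$ with $\sigma_i=\operatorname{sgn}(x_i(t))$ if $x_i(t)\ne0$ and $\sigma_i\in[-1,1]$ if $x_i(t)=0$. Assume that for every $t\ge0$ the state $x(t)$ and the fluctuation $v(t)-v_{nom}$ are independent. **Theorem.** The origin is attainable by $x(t)$. That is: 1. (attractiveness and subtangentiality) the velocity $\dot x(t)$ exists for almost every $t$ with probability one and has a jointly measurable version, for which, for almost every $t\ge 0$, $x(t)^T\dot x(t)$ and $\dot x(t)$ are integrable and, with probability one, $$\mathbb E[x(t)^T\dot x(t)\mid x(t)]<0\ \text{ if } x(t)\neq0,\qquad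 \mathbb E[\dot x(t)\mid x(t)]=0\ \text{ if } x(t)=0;$$ 2. (convergence) $\lim_{t\to\infty}x(t)=0$ with probability one; 3. (invariance) with probability one, for all $0\le s\le t$, if $x(s)=0$ then $x(t)=0$. -/

import Mathlib

open MeasureTheory ProbabilityTheory Filter Topology
open scoped Matrix

noncomputable section

namespace DynTU

/-- The nonempty coalitions of the player set `Fin n`; there are `m = 2 ^ n - 1` of them. -/
abbrev Coalition (n : ℕ) : Type := {S : Finset (Fin n) // S.Nonempty}

/-- The nonempty coalitions other than the grand coalition. -/
abbrev ProperCoalition (n : ℕ) : Type := {S : Coalition n // S.1 ≠ Finset.univ}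

/-- Index set of the control `u = (a, s)`: one allocation per player and one surplus per
coalition other than the grand coalition, `n + m - 1` entries in all. -/
abbrev ControlIdx (n : ℕ) : Type := Fin n ⊕ ProperCoalition n

/-- Incidence matrix of the coalition hypergraph: the rows are the characteristic vectors. -/
def incidence (n : ℕ) : Matrix (Coalition n) (Fin n) ℝ :=
  Matrix.of fun S i => if i ∈ S.1 then 1 else 0

/-- The block `[-I; 0]` that subtracts the surplus of every coalition but the grand one. -/
def surplusBlock (n : ℕ) : Matrix (Coalition n) (ProperCoalition n) ℝ :=
  Matrix.of fun S T => if S = T.1 then -1 else 0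

/-- The matrix `B = [B_H | [-I; 0]]`. -/
def flowMatrix (n : ℕ) : Matrix (Coalition n) (ControlIdx n) ℝ :=
  Matrix.fromCols (incidence n) (surplusBlock n)

/-- The feasible controls `u = (a, s)` with `a_min ≤ a ≤ a_max` and `s ≥ 0`. -/
def feasible {n : ℕ} (amin amax : Fin n → ℝ) : Set (ControlIdx n → ℝ) :=
  {u | (∀ i, amin i ≤ u (Sum.inl i) ∧ u (Sum.inl i) ≤ amax i) ∧ ∀ T, 0 ≤ u (Sum.inr T)}

/-- Componentwise sign, with `sgn 0 = 0`. -/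
def sgn {ι : Type*} (y : ι → ℝ) : ι → ℝ := fun i => Real.sign (y i)

/-- The Filippov regularization of the componentwise sign: the sign itself in the nonzero
components, and any value of `[-1, 1]` in the vanishing ones. -/
def filippovSgn {ι : Type*} (y : ι → ℝ) : Set (ι → ℝ) :=
  {σ | ∀ i, (y i ≠ 0 → σ i = Real.sign (y i)) ∧ (y i = 0 → σ i ∈ Set.Icc (-1 : ℝ) 1)}

/-- The ordinary sign is one of the values of the Filippov regularization, so that classical
(Carathéodory) solutions are Filippov solutions. -/
theorem sgn_mem_filippovSgn {ι : Type*} (y : ι → ℝ) : sgn y ∈ filippovSgn y := by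
  intro i
  refine ⟨fun _ => rfl, fun h => ?_⟩
  simp [sgn, h]

/-- The sign-based feedback `σ ↦ u_nom - δ B† σ`. -/
def signControl {n : ℕ} (unom : ControlIdx n → ℝ) (δ : ℝ)
    (Bd : Matrix (ControlIdx n) (Coalition n) ℝ) (σ : Coalition n → ℝ) : ControlIdx n → ℝ :=
  unom - δ • (Bd *ᵥ σ)

/-- The data of an admissible sign-based controller: a positive gain, a pseudo-inverse `B†` of `B`
(`B B† = I`), a feasible nominal control with `B u_nom = v_nom`, and feasibility of
`u_nom - δ B† sgn y` for every state `y`. -/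
structure IsSignController {n : ℕ} (amin amax : Fin n → ℝ) (vnom : Coalition n → ℝ)
    (unom : ControlIdx n → ℝ) (δ : ℝ) (Bd : Matrix (ControlIdx n) (Coalition n) ℝ) : Prop where
  gain_pos : 0 < δ
  pseudoInverse : flowMatrix n * Bd = 1
  nominal_feasible : unom ∈ feasible amin amax
  nominal_balance : flowMatrix n *ᵥ unom = vnom
  feedback_feasible : ∀ y : Coalition n → ℝ, signControl unom δ Bd (sgn y) ∈ feasible amin amax

/-- `v` is a bounded mean ergodic process with values in the bounded convex set `V`, one-time
law `law` and long-run average `vnom`. -/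
structure IsBoundedMeanErgodic {Ω : Type*} [MeasurableSpace Ω] (P : Measure Ω) {n : ℕ}
    (V : Set (Coalition n → ℝ)) (law : Measure (Coalition n → ℝ))
    (v : ℝ → Ω → Coalition n → ℝ) (vnom : Coalition n → ℝ) : Prop where
  bounded : Bornology.IsBounded V
  convex : Convex ℝ V
  measurable : Measurable (Function.uncurry v)
  mem : ∀ t, 0 ≤ t → ∀ ω, v t ω ∈ V
  map_eq : ∀ t, 0 ≤ t → P.map (v t) = law
  mean : ∀ t, 0 ≤ t → ∫ ω, v t ω ∂P = vnom
  ergodic : ∀ᵐ ω ∂P, Tendsto (fun τ : ℝ => τ⁻¹ • ∫ s in (0 : ℝ)..τ, v s ω) atTop (𝓝 vnom)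

/-- `x` is a state process of `ẋ = B u - v` under the feedback `u = u_nom - δ B† sgn x`, in the
sense of Filippov: almost every path is absolutely continuous and is driven by a (measurable)
control that at almost every time is a value of the regularized feedback. -/
structure IsClosedLoop {Ω : Type*} [MeasurableSpace Ω] (P : Measure Ω) {n : ℕ}
    (unom : ControlIdx n → ℝ) (δ : ℝ) (Bd : Matrix (ControlIdx n) (Coalition n) ℝ)
    (v : ℝ → Ω → Coalition n → ℝ) (u : ℝ → Ω → ControlIdx n → ℝ)
    (x : ℝ → Ω → Coalition n → ℝ) : Prop where
  measurable_state : ∀ t, 0 ≤ t → Measurable (x t)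
  measurable_control : Measurable (Function.uncurry u)
  control_mem : ∀ᵐ ω ∂P, ∀ᵐ t ∂(volume.restrict (Set.Ici (0 : ℝ))),
    u t ω ∈ signControl unom δ Bd '' filippovSgn (x t ω)
  state_eq : ∀ᵐ ω ∂P, ∀ t, 0 ≤ t →
    x t ω = x 0 ω + ∫ s in (0 : ℝ)..t, (flowMatrix n *ᵥ u s ω - v s ω)

/-- The origin is attainable by the random process `x`, with velocity `ẋ = w`: for almost every
time, given the current state, the expected value of `xᵀ ẋ` is negative off the origin
(attractiveness) and the expected velocity vanishes at the origin (subtangentiality); almost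
surely the path converges to the origin, and does not leave it once there. -/
def OriginAttainable {Ω : Type*} [MeasurableSpace Ω] (P : Measure Ω) {ι : Type*} [Fintype ι]
    (x : ℝ → Ω → ι → ℝ) : Prop :=
  (∃ w : ℝ → Ω → ι → ℝ, Measurable (Function.uncurry w) ∧
    (∀ᵐ ω ∂P, ∀ᵐ t ∂(volume.restrict (Set.Ici (0 : ℝ))),
      HasDerivAt (fun s => x s ω) (w t ω) t) ∧
    ∀ᵐ t ∂(volume.restrict (Set.Ici (0 : ℝ))),
      Integrable (fun ω => x t ω ⬝ᵥ w t ω) P ∧ Integrable (w t) P ∧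
      ∀ᵐ ω ∂P,
        (x t ω ≠ 0 →
          (P[fun ω' => x t ω' ⬝ᵥ w t ω' | MeasurableSpace.comap (x t) inferInstance]) ω < 0) ∧
        (x t ω = 0 →
          (P[w t | MeasurableSpace.comap (x t) inferInstance]) ω = 0)) ∧
  (∀ᵐ ω ∂P, Tendsto (fun t => x t ω) atTop (𝓝 0)) ∧
  (∀ᵐ ω ∂P, ∀ s, 0 ≤ s → x s ω = 0 → ∀ t, s ≤ t → x t ω = 0)

end DynTU

end

/-! Since `B B† = I` and `B u_nom = v_nom`, the closed loop decouples into scalar equations `y' = -δ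
σ - d`, with `σ` a regularized sign of `y` and `d` a centred disturbance independent of `y` at each
time.

Integrating `|y|' = sgn(y) y'` gives `|y(t)| + δ · (time off zero up to t) = |y(0)| - ∫ sgn(y) d`.
By independence the last integral has mean zero, so the expected time off zero is at most `E|y(0)| /
δ` (`measure_offZero_restrict_le`), and almost every path spends only finite time off zero.

The gain is not assumed to dominate the disturbance; this is deduced (`ae_abs_disturbance_le`). At
almost every zero of a path the velocity vanishes, which forces `|d| ≤ δ` there. By independence,
`P(y = 0) P(|d| > δ) = 0` at almost every time. If `|d| > δ` had positive probability at all times,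
`y` would almost surely be off zero at almost all times, contradicting the finite time off zero. As
the law of `d` does not depend on time, `|d| ≤ δ` almost surely at every time.

Hence `|y|` is nonincreasing: zero is absorbing, and it is reached in finite time. Attractiveness is
a computation of conditional expectations: `E[xᵀ ẋ | x] = -δ ‖x‖₁`. -/

namespace DynTU

/-! ### Zeros and absolute values of integral paths -/

/-- At almost every zero of a function, its derivative vanishes if it exists. -/
theorem ae_hasDerivAt_eq_zero_of_eq_zero (f : ℝ → ℝ) :
    ∀ᵐ t, ∀ f', HasDerivAt f f' t → f t = 0 → f' = 0 := by
  -- Zeros isolated from the right are countable, hence null; a nonzero derivative at a zero would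
  -- make it such a point.
  have hc := countable_setOfPred_isolated_right_within (s := {t : ℝ | f t = 0})
  filter_upwards [hc.ae_notMem volume] with t ht f' hf h0
  by_contra hne
  refine ht ⟨h0, ?_⟩
  have h1 : ∀ᶠ z in 𝓝[≠] t, f z ≠ 0 := hf.eventually_ne hne
  have h2 : ∀ᶠ z in 𝓝[{t : ℝ | f t = 0} ∩ Set.Ioi t] t, f z ≠ 0 :=
    h1.filter_mono (nhdsWithin_mono _ fun z hz => (ne_of_gt hz.2))
  have h3 : ∀ᶠ z in 𝓝[{t : ℝ | f t = 0} ∩ Set.Ioi t] t,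
      z ∈ {t : ℝ | f t = 0} ∩ Set.Ioi t := self_mem_nhdsWithin
  rw [← Filter.eventually_false_iff_eq_bot]
  filter_upwards [h2, h3] with z hz hz' using hz hz'.1

theorem intervalIntegrable_of_ae_abs_le {g : ℝ → ℝ} {C s t : ℝ} (hg : Measurable g)
    (hC : ∀ᵐ r ∂(volume.restrict (Set.Ici (0 : ℝ))), |g r| ≤ C) (hs : 0 ≤ s) (ht : 0 ≤ t) :
    IntervalIntegrable g volume s t := by
  rw [intervalIntegrable_iff]
  refine Measure.integrableOn_of_bounded (M := C) (by simp) hg.aestronglyMeasurable ?_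
  refine ae_mono (Measure.restrict_mono (fun r hr => ?_) le_rfl) hC
  exact (le_min hs ht).trans (Set.uIoc_subset_uIcc hr).1

/-- A path on `[0, ∞)` that is the integral of an essentially bounded measurable velocity. -/
structure IsIntegralPath (y g : ℝ → ℝ) (C : ℝ) : Prop where
  meas : Measurable g
  bound : ∀ᵐ s ∂(volume.restrict (Set.Ici (0 : ℝ))), |g s| ≤ C
  eq_integral : ∀ t, 0 ≤ t → y t = y 0 + ∫ s in (0 : ℝ)..t, g s

namespace IsIntegralPath

variable {y g : ℝ → ℝ} {C : ℝ}

theorem intervalIntegrable (h : IsIntegralPath y g C) {s t : ℝ} (hs : 0 ≤ s) (ht : 0 ≤ t) :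
    IntervalIntegrable g volume s t :=
  intervalIntegrable_of_ae_abs_le h.meas h.bound hs ht

theorem sub_eq (h : IsIntegralPath y g C) {s t : ℝ} (hs : 0 ≤ s) (ht : 0 ≤ t) :
    y t - y s = ∫ r in s..t, g r := by
  rw [h.eq_integral t ht, h.eq_integral s hs, ← intervalIntegral.integral_interval_sub_left
    (h.intervalIntegrable le_rfl ht) (h.intervalIntegrable le_rfl hs)]
  ring

theorem ae_hasDerivAt (h : IsIntegralPath y g C) :
    ∀ᵐ t ∂(volume.restrict (Set.Ici (0 : ℝ))), HasDerivAt y (g t) t := by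
  rw [ae_restrict_iff' measurableSet_Ici]
  have h1 : ∀ᵐ t : ℝ, ∀ k : ℕ, t ∈ Set.uIcc (0 : ℝ) k → ∀ c ∈ Set.uIcc (0 : ℝ) k,
      HasDerivAt (fun x => ∫ r in c..x, g r) (g t) t :=
    ae_all_iff.2 fun k =>
      (h.intervalIntegrable le_rfl k.cast_nonneg).ae_hasDerivAt_integral
  -- The derivative is two-sided but the integral formula holds only on `[0, ∞)`, so time `0` is
  -- discarded.
  have h2 : ∀ᵐ t : ℝ, t ≠ 0 := by simp [ae_iff]
  filter_upwards [h1, h2] with t ht ht0 htp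
  have htp' : 0 < t := lt_of_le_of_ne htp (Ne.symm ht0)
  obtain ⟨k, hk⟩ := exists_nat_ge t
  have hd := (ht k (by rw [Set.uIcc_of_le k.cast_nonneg]; exact ⟨htp, hk⟩) 0
    Set.left_mem_uIcc).const_add (y 0)
  refine hd.congr_of_eventuallyEq ?_
  filter_upwards [eventually_gt_nhds htp'] with r hr using h.eq_integral r hr.le

theorem ae_eq_zero (h : IsIntegralPath y g C) :
    ∀ᵐ t ∂(volume.restrict (Set.Ici (0 : ℝ))), y t = 0 → g t = 0 := by
  filter_upwards [h.ae_hasDerivAt, ae_restrict_of_ae (ae_hasDerivAt_eq_zero_of_eq_zero y)]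
    with t h1 h2 h3 using h2 _ h1 h3

theorem bound_nonneg (h : IsIntegralPath y g C) : 0 ≤ C := by
  have : (ae (volume.restrict (Set.Ici (0 : ℝ)))).NeBot := by
    rw [ae_neBot]; simp
  obtain ⟨t, ht⟩ := h.bound.exists
  exact (abs_nonneg _).trans ht

theorem abs_sub_le (h : IsIntegralPath y g C) {s t : ℝ} (hs : 0 ≤ s) (ht : 0 ≤ t) :
    |y t - y s| ≤ C * |t - s| := by
  rw [h.sub_eq hs ht]
  rw [← Real.norm_eq_abs]
  refine intervalIntegral.norm_integral_le_of_norm_le_const_ae ?_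
  have := (ae_restrict_iff' measurableSet_Ici).1 h.bound
  filter_upwards [this] with r hr hr'
  exact hr ((le_min hs ht).trans (Set.uIoc_subset_uIcc hr').1)

/-- `|y|` is Lipschitz, hence the integral of its almost everywhere derivative. At zeros of `y` the
convention `Real.sign 0 = 0` is the right one, since the derivative of `|y|` vanishes at almost all
of them. -/
theorem abs_sub_abs (h : IsIntegralPath y g C) {s t : ℝ} (hs : 0 ≤ s) (ht : 0 ≤ t) :
    |y t| - |y s| = ∫ r in s..t, Real.sign (y r) * g r := by
  have hsub : Set.uIcc s t ⊆ Set.Ici 0 := fun r hr => (le_min hs ht).trans hr.1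
  have hL : LipschitzOnWith C.toNNReal (fun r => |y r|) (Set.uIcc s t) := by
    refine LipschitzOnWith.of_dist_le_mul fun a ha b hb => ?_
    rw [Real.dist_eq, Real.dist_eq, Real.coe_toNNReal _ h.bound_nonneg]
    exact (abs_abs_sub_abs_le _ _).trans (h.abs_sub_le (hsub hb) (hsub ha))
  rw [← hL.absolutelyContinuousOnInterval.integral_deriv_eq_sub]
  refine intervalIntegral.integral_congr_ae ?_
  filter_upwards [(ae_restrict_iff' measurableSet_Ici).1 h.ae_hasDerivAt,
    (ae_restrict_iff' measurableSet_Ici).1 h.ae_eq_zero,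
    ae_hasDerivAt_eq_zero_of_eq_zero fun r => |y r|] with r h1 h2 h3 hr
  have hr0 : r ∈ Set.Ici (0 : ℝ) := hsub (Set.uIoc_subset_uIcc hr)
  rcases lt_trichotomy (y r) 0 with hy | hy | hy
  · have := (hasDerivAt_abs_neg hy).comp r (h1 hr0)
    rw [Real.sign_of_neg hy]
    exact this.deriv
  · rw [hy, Real.sign_zero, zero_mul]
    -- Where `|y|` is not differentiable, `deriv` takes the default value `0`, which is also the
    -- value required.
    by_cases hdiff : DifferentiableAt ℝ (fun r => |y r|) r
    · exact h3 _ hdiff.hasDerivAt (by simp [hy])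
    · exact deriv_zero_of_not_differentiableAt hdiff
  · have := (hasDerivAt_abs_pos hy).comp r (h1 hr0)
    rw [Real.sign_of_pos hy]
    exact this.deriv

end IsIntegralPath
end DynTU

/-! ### The scalar sign loop -/

namespace DynTU

theorem measurable_sign : Measurable Real.sign :=
  Measurable.ite measurableSet_Iio measurable_const
    (Measurable.ite measurableSet_Ioi measurable_const measurable_const)

theorem abs_sign_le_one (r : ℝ) : |Real.sign r| ≤ 1 := by
  rcases Real.sign_apply_eq r with h | h | h <;> simp [h]

theorem sign_mul_self_of_ne_zero {r : ℝ} (hr : r ≠ 0) : Real.sign r * Real.sign r = 1 := by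
  rcases Real.sign_apply_eq_of_ne_zero r hr with h | h <;> simp [h]

/-- A scalar random process `y` with velocity `g`, driven by the regularized sign feedback with
gain `δ` against a bounded centred disturbance `d` with time-invariant one-time law, where
`y t` and `d t` are independent. -/
structure IsSignLoop {Ω : Type*} [MeasurableSpace Ω] (P : Measure Ω) (δ C : ℝ)
    (y g d : ℝ → Ω → ℝ) : Prop where
  gain_pos : 0 < δ
  meas_state : Measurable (Function.uncurry y)
  meas_velocity : Measurable (Function.uncurry g)
  meas_disturbance : Measurable (Function.uncurry d)
  eq_integral : ∀ᵐ ω ∂P, ∀ t, 0 ≤ t → y t ω = y 0 ω + ∫ s in (0 : ℝ)..t, g s ω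
  abs_disturbance_le : ∀ t, 0 ≤ t → ∀ ω, |d t ω| ≤ C
  velocity_eq : ∀ᵐ ω ∂P, ∀ᵐ t ∂(volume.restrict (Set.Ici (0 : ℝ))),
    ∃ σ, (y t ω ≠ 0 → σ = Real.sign (y t ω)) ∧ (y t ω = 0 → σ ∈ Set.Icc (-1 : ℝ) 1) ∧
      g t ω = -δ * σ - d t ω
  integrable_zero : Integrable (y 0) P
  indep : ∀ t, 0 ≤ t → IndepFun (y t) (d t) P
  mean_zero : ∀ t, 0 ≤ t → ∫ ω, d t ω ∂P = 0
  map_eq : ∀ s t, 0 ≤ s → 0 ≤ t → P.map (d s) = P.map (d t)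

namespace IsSignLoop

variable {Ω : Type*} [MeasurableSpace Ω] {P : Measure Ω} {δ C : ℝ}
  {y g d : ℝ → Ω → ℝ}

theorem isIntegralPath (h : IsSignLoop P δ C y g d) :
    ∀ᵐ ω ∂P, IsIntegralPath (fun t => y t ω) (fun t => g t ω) (δ + C) := by
  filter_upwards [h.eq_integral, h.velocity_eq] with ω h1 h2
  refine ⟨h.meas_velocity.of_uncurry_right, ?_, h1⟩
  filter_upwards [h2, ae_restrict_mem measurableSet_Ici] with t ht ht0
  obtain ⟨σ, hσ1, hσ2, hg⟩ := ht
  have hσ : |σ| ≤ 1 := by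
    by_cases hy : y t ω = 0
    · exact abs_le.2 (hσ2 hy)
    · rw [hσ1 hy]; exact abs_sign_le_one _
  have hd := h.abs_disturbance_le t ht0 ω
  have hδ := h.gain_pos
  rw [hg]
  calc |-δ * σ - d t ω| ≤ |-δ * σ| + |d t ω| := abs_sub _ _
    _ = δ * |σ| + |d t ω| := by rw [abs_mul, abs_neg, abs_of_pos hδ]
    _ ≤ δ + C := by nlinarith

/-- Off zero the velocity is the feedback minus the disturbance; at zero it vanishes, and the
disturbance does not exceed the gain. -/
theorem velocity (h : IsSignLoop P δ C y g d) :
    ∀ᵐ ω ∂P, ∀ᵐ t ∂(volume.restrict (Set.Ici (0 : ℝ))),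
      (y t ω ≠ 0 → g t ω = -δ * Real.sign (y t ω) - d t ω) ∧
      (y t ω = 0 → g t ω = 0 ∧ |d t ω| ≤ δ) := by
  filter_upwards [h.isIntegralPath, h.velocity_eq] with ω h1 h2
  filter_upwards [h1.ae_eq_zero, h2] with t h3 h4
  obtain ⟨σ, hσ1, hσ2, hg⟩ := h4
  refine ⟨fun hy => by rw [hg, hσ1 hy], fun hy => ⟨h3 hy, ?_⟩⟩
  have hd : d t ω = -δ * σ := by linarith [h3 hy]
  rw [hd, abs_mul, abs_neg, abs_of_pos h.gain_pos]
  exact mul_le_of_le_one_right h.gain_pos.le (abs_le.2 (hσ2 hy))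

/-- The positive times at which the process is off zero. -/
def offZero (y : ℝ → Ω → ℝ) : Set (Ω × ℝ) := {q | 0 < q.2 ∧ y q.2 q.1 ≠ 0}

theorem measurableSet_offZero (h : IsSignLoop P δ C y g d) : MeasurableSet (offZero y) :=
  (measurableSet_lt measurable_const measurable_snd).inter
    (h.meas_state.comp measurable_swap (measurableSet_singleton 0)).compl

/-- The square of the sign is the indicator of `y ≠ 0`, so its integral is the time spent off zero.
-/
theorem abs_add_time_off_zero (h : IsSignLoop P δ C y g d) :
    ∀ᵐ ω ∂P, ∀ t, 0 ≤ t →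
      |y t ω| + δ * ∫ r in (0 : ℝ)..t, Real.sign (y r ω) * Real.sign (y r ω) =
        |y 0 ω| - ∫ r in (0 : ℝ)..t, Real.sign (y r ω) * d r ω := by
  filter_upwards [h.isIntegralPath, h.velocity] with ω h1 h2 t ht
  have hym : Measurable fun r => Real.sign (y r ω) :=
    measurable_sign.comp h.meas_state.of_uncurry_right
  have hdm : Measurable fun r => d r ω := h.meas_disturbance.of_uncurry_right
  have hi1 : IntervalIntegrable (fun r => Real.sign (y r ω) * Real.sign (y r ω)) volume 0 t := by
    rw [intervalIntegrable_iff]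
    refine Measure.integrableOn_of_bounded (M := 1) (by simp)
      (hym.mul hym).aestronglyMeasurable (ae_of_all _ fun r => ?_)
    rw [Real.norm_eq_abs, abs_mul]
    exact mul_le_one₀ (abs_sign_le_one _) (abs_nonneg _) (abs_sign_le_one _)
  have hi2 : IntervalIntegrable (fun r => Real.sign (y r ω) * d r ω) volume 0 t := by
    rw [intervalIntegrable_iff, Set.uIoc_of_le ht]
    refine Measure.integrableOn_of_bounded (M := C) (by simp)
      (hym.mul hdm).aestronglyMeasurable
      ((ae_restrict_mem measurableSet_Ioc).mono fun r hr => ?_)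
    rw [Real.norm_eq_abs, abs_mul]
    have h3 := h.abs_disturbance_le r hr.1.le ω
    have h4 := abs_sign_le_one (y r ω)
    exact (mul_le_of_le_one_left (abs_nonneg _) h4).trans h3
  have hint : ∫ r in (0 : ℝ)..t, Real.sign (y r ω) * g r ω =
      ∫ r in (0 : ℝ)..t, (-δ * (Real.sign (y r ω) * Real.sign (y r ω))
        - Real.sign (y r ω) * d r ω) := by
    refine intervalIntegral.integral_congr_ae ?_
    filter_upwards [(ae_restrict_iff' measurableSet_Ici).1 h2] with r hr hr'
    rw [Set.uIoc_of_le ht] at hr'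
    have hr2 := hr hr'.1.le
    by_cases hy : y r ω = 0
    · simp [hy]
    · rw [hr2.1 hy]; ring
  have := h1.abs_sub_abs le_rfl ht
  rw [hint, intervalIntegral.integral_sub (hi1.const_mul _) hi2,
    intervalIntegral.integral_const_mul] at this
  linarith

variable [IsProbabilityMeasure P]

/-- With `σ` eliminated, the property defines a jointly measurable set, so Fubini exchanges "almost
every path" and "almost every time". -/
theorem velocity_swap (h : IsSignLoop P δ C y g d) :
    ∀ᵐ t ∂(volume.restrict (Set.Ici (0 : ℝ))), ∀ᵐ ω ∂P,
      (y t ω ≠ 0 → g t ω = -δ * Real.sign (y t ω) - d t ω) ∧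
      (y t ω = 0 → g t ω = 0 ∧ |d t ω| ≤ δ) := by
  have hy : Measurable fun q : Ω × ℝ => y q.2 q.1 := h.meas_state.comp measurable_swap
  have hg : Measurable fun q : Ω × ℝ => g q.2 q.1 := h.meas_velocity.comp measurable_swap
  have hd : Measurable fun q : Ω × ℝ => d q.2 q.1 := h.meas_disturbance.comp measurable_swap
  refine (Measure.ae_ae_comm ?_).1 h.velocity
  have h0 : MeasurableSet {q : Ω × ℝ | y q.2 q.1 = 0} := hy (measurableSet_singleton 0)
  have h1 : MeasurableSet {q : Ω × ℝ | g q.2 q.1 = 0} := hg (measurableSet_singleton 0)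
  have h2 : MeasurableSet {q : Ω × ℝ | |d q.2 q.1| ≤ δ} :=
    measurableSet_le hd.abs measurable_const
  have h3 : MeasurableSet {q : Ω × ℝ | g q.2 q.1 = -δ * Real.sign (y q.2 q.1) - d q.2 q.1} :=
    measurableSet_eq_fun hg (((measurable_sign.comp hy).const_mul _).sub hd)
  exact (h0.compl.imp h3).inter (h0.imp (h1.inter h2))

theorem integrable_sign_mul_disturbance (h : IsSignLoop P δ C y g d) (T : ℝ) :
    Integrable (Function.uncurry fun ω r => Real.sign (y r ω) * d r ω)
      (P.prod (volume.restrict (Set.Ioc 0 T))) := by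
  have hm : Measurable (Function.uncurry fun ω r => Real.sign (y r ω) * d r ω) :=
    (measurable_sign.comp (h.meas_state.comp measurable_swap)).mul
      (h.meas_disturbance.comp measurable_swap)
  refine Integrable.of_bound hm.aestronglyMeasurable C ?_
  have hms : MeasurableSet {q : Ω × ℝ | 0 < q.2} := measurableSet_lt measurable_const measurable_snd
  have : ∀ᵐ q ∂(P.prod (volume.restrict (Set.Ioc 0 T))), 0 < q.2 := by
    rw [Measure.ae_prod_iff_ae_ae hms]
    exact ae_of_all _ fun ω => (ae_restrict_mem measurableSet_Ioc).mono fun r hr => hr.1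
  filter_upwards [this] with q hq
  simp only [Function.uncurry, Real.norm_eq_abs, abs_mul]
  exact (mul_le_of_le_one_left (abs_nonneg _) (abs_sign_le_one _)).trans (h.abs_disturbance_le q.2 hq.le q.1)

/-- After Fubini, independence at each fixed time factors the expectation, and the factor `E[d]` is
zero. -/
theorem integral_sign_mul_disturbance (h : IsSignLoop P δ C y g d) {T : ℝ} (hT : 0 ≤ T) :
    ∫ ω, (∫ r in (0 : ℝ)..T, Real.sign (y r ω) * d r ω) ∂P = 0 := by
  simp only [intervalIntegral.integral_of_le hT]
  rw [integral_integral_swap (h.integrable_sign_mul_disturbance T)]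
  rw [setIntegral_congr_fun (g := fun _ => (0 : ℝ)) measurableSet_Ioc fun r hr => ?_]
  · simp
  have hi : IndepFun (fun ω => Real.sign (y r ω)) (d r) P :=
    (h.indep r hr.1.le).comp measurable_sign measurable_id
  have := hi.integral_fun_mul_eq_mul_integral
    (measurable_sign.comp h.meas_state.of_uncurry_left).aestronglyMeasurable
    h.meas_disturbance.of_uncurry_left.aestronglyMeasurable
  simp only
  rw [this, h.mean_zero r hr.1.le, mul_zero]

/-- Expectation of the balance in `abs_add_time_off_zero`, with `|y(T)| ≥ 0` dropped. The bound does
not depend on `T`, so it survives `T → ∞`. -/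
theorem measure_offZero_restrict_le (h : IsSignLoop P δ C y g d) {T : ℝ} (hT : 0 ≤ T) :
    (P.prod (volume.restrict (Set.Ioc 0 T))) (offZero y) ≤
      ENNReal.ofReal (δ⁻¹ * ∫ ω, |y 0 ω| ∂P) := by
  have hm := h.measurableSet_offZero
  rw [← ENNReal.ofReal_toReal (measure_ne_top _ (offZero y))]
  refine ENNReal.ofReal_le_ofReal ?_
  have hint : Integrable ((offZero y).indicator (1 : Ω × ℝ → ℝ))
      (P.prod (volume.restrict (Set.Ioc 0 T))) :=
    (integrable_const (1 : ℝ)).indicator hm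
  change (P.prod (volume.restrict (Set.Ioc 0 T))).real (offZero y) ≤ _
  rw [← integral_indicator_one hm, integral_prod _ hint]
  have hi1 : Integrable (fun ω => ∫ r in (0 : ℝ)..T, Real.sign (y r ω) * d r ω) P := by
    simp only [intervalIntegral.integral_of_le hT]
    exact (h.integrable_sign_mul_disturbance T).integral_prod_left
  have hsub := integral_sub h.integrable_zero.abs hi1
  rw [h.integral_sign_mul_disturbance hT, sub_zero] at hsub
  rw [← hsub, ← integral_const_mul]
  refine integral_mono_ae hint.integral_prod_left ((h.integrable_zero.abs.sub hi1).const_mul _) ?_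
  filter_upwards [h.abs_add_time_off_zero] with ω hω
  have h1 := hω T hT
  have h2 : ∫ r in (0 : ℝ)..T, Real.sign (y r ω) * Real.sign (y r ω) =
      ∫ r in Set.Ioc 0 T, (offZero y).indicator (1 : Ω × ℝ → ℝ) (ω, r) := by
    rw [intervalIntegral.integral_of_le hT]
    refine setIntegral_congr_fun measurableSet_Ioc fun r hr => ?_
    by_cases hy : y r ω = 0
    · simp [offZero, hy]
    · simp [offZero, hy, hr.1, sign_mul_self_of_ne_zero hy]
  rw [h2] at h1
  have h3 := abs_nonneg (y T ω)
  have h4 := h.gain_pos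
  rw [le_inv_mul_iff₀ h4]
  linarith

theorem ae_measure_offZero_lt_top (h : IsSignLoop P δ C y g d) :
    ∀ᵐ ω ∂P, volume {t | 0 < t ∧ y t ω ≠ 0} < ⊤ := by
  have hm := h.measurableSet_offZero
  refine Measure.ae_measure_lt_top hm (ne_top_of_le_ne_top ENNReal.ofReal_ne_top
    (b := ENNReal.ofReal (δ⁻¹ * ∫ ω, |y 0 ω| ∂P)) ?_)
  have hU : offZero y = ⋃ k : ℕ, offZero y ∩ Set.univ ×ˢ Set.Ioc (0 : ℝ) k := by
    ext q
    simp only [Set.mem_iUnion, Set.mem_inter_iff, Set.mem_prod, Set.mem_univ, true_and]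
    refine ⟨fun hq => ?_, fun ⟨_, hq⟩ => hq.1⟩
    obtain ⟨k, hk⟩ := exists_nat_ge q.2
    exact ⟨k, hq, hq.1, hk⟩
  rw [hU, Monotone.measure_iUnion]
  · refine iSup_le fun k => ?_
    have := h.measure_offZero_restrict_le (T := k) k.cast_nonneg
    rw [← Measure.restrict_univ (μ := P), Measure.prod_restrict, Measure.restrict_apply hm] at this
    simpa using this
  · intro a b hab
    have : Set.Ioc (0 : ℝ) a ⊆ Set.Ioc 0 b := Set.Ioc_subset_Ioc_right (by exact_mod_cast hab)
    exact Set.inter_subset_inter_right _ (Set.prod_mono_right this)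

/-- The feedback dominates the disturbance. -/
theorem ae_abs_disturbance_le (h : IsSignLoop P δ C y g d) {t : ℝ} (ht : 0 ≤ t) :
    ∀ᵐ ω ∂P, |d t ω| ≤ δ := by
  have hset : MeasurableSet {r : ℝ | δ < |r|} := measurableSet_lt measurable_const measurable_id.abs
  -- One such time suffices, because the law of `d` is the same at all times.
  obtain ⟨s, hs, hs0⟩ : ∃ s, 0 ≤ s ∧ P {ω | δ < |d s ω|} = 0 := by
    by_contra! hcon
    have hne : ∀ᵐ s ∂(volume.restrict (Set.Ici (0 : ℝ))), ∀ᵐ ω ∂P, y s ω ≠ 0 := by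
      filter_upwards [h.velocity_swap, ae_restrict_mem measurableSet_Ici] with s h1 hs
      have hprod := (h.indep s hs).measure_inter_preimage_eq_mul {0} {r : ℝ | δ < |r|}
        (measurableSet_singleton 0) hset
      -- At a zero of `y` the vanishing velocity forces `|d| ≤ δ`, so the two events are almost
      -- surely disjoint.
      have hzero : P (y s ⁻¹' {0} ∩ d s ⁻¹' {r : ℝ | δ < |r|}) = 0 := by
        refine measure_mono_null (fun ω hω => ?_) (ae_iff.1 h1)
        intro hcon
        exact absurd (hcon.2 hω.1).2 (not_le.2 hω.2)
      rw [hzero] at hprod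
      rcases mul_eq_zero.1 hprod.symm with h2 | h2
      · rw [ae_iff]
        simpa [Set.preimage] using h2
      · exact absurd h2 (hcon s hs)
    have hm : MeasurableSet {q : ℝ × Ω | y q.1 q.2 ≠ 0} :=
      (h.meas_state (measurableSet_singleton 0)).compl
    have hne' := (Measure.ae_ae_comm hm).1 hne
    obtain ⟨ω, h1, h2⟩ := (hne'.and h.ae_measure_offZero_lt_top).exists
    rw [ae_restrict_iff' measurableSet_Ici] at h1
    have : volume (Set.Ioi (0 : ℝ)) ≤ volume {t | 0 < t ∧ y t ω ≠ 0} := by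
      refine measure_mono_ae ?_
      filter_upwards [h1] with r hr hr0
      exact ⟨hr0, hr (le_of_lt hr0)⟩
    rw [Real.volume_Ioi, top_le_iff] at this
    exact h2.ne this
  have hmap := h.map_eq s t hs ht
  rw [ae_iff]
  simp only [not_le]
  have h1 := congrArg (fun μ => μ {r : ℝ | δ < |r|}) hmap
  rw [Measure.map_apply h.meas_disturbance.of_uncurry_left hset,
    Measure.map_apply h.meas_disturbance.of_uncurry_left hset] at h1
  exact h1.symm.trans hs0

/-- Off zero, `|y|` has derivative `-δ - sgn(y) d`, which is nonpositive once `|d| ≤ δ`. -/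
theorem ae_antitone (h : IsSignLoop P δ C y g d) :
    ∀ᵐ ω ∂P, ∀ s t, 0 ≤ s → s ≤ t → |y t ω| ≤ |y s ω| := by
  have hd : ∀ᵐ t ∂(volume.restrict (Set.Ici (0 : ℝ))), ∀ᵐ ω ∂P, |d t ω| ≤ δ :=
    (ae_restrict_mem measurableSet_Ici).mono fun t ht => h.ae_abs_disturbance_le ht
  have hm : MeasurableSet {q : ℝ × Ω | |d q.1 q.2| ≤ δ} :=
    measurableSet_le h.meas_disturbance.abs measurable_const
  filter_upwards [(Measure.ae_ae_comm hm).1 hd, h.isIntegralPath, h.velocity]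
    with ω h1 h2 h3 s t hs hst
  rw [← sub_nonpos, h2.abs_sub_abs hs (hs.trans hst), intervalIntegral.integral_of_le hst]
  refine integral_nonpos_of_ae ?_
  have hle : volume.restrict (Set.Ioc s t) ≤ volume.restrict (Set.Ici (0 : ℝ)) :=
    Measure.restrict_mono (fun r hr => hs.trans hr.1.le) le_rfl
  filter_upwards [ae_mono hle h1, ae_mono hle h3] with r hr1 hr2
  simp only [Pi.zero_apply]
  by_cases hy : y r ω = 0
  · simp [hy]
  · rw [hr2.1 hy]
    have h4 := abs_le.1 hr1
    rcases Real.sign_apply_eq_of_ne_zero _ hy with h5 | h5 <;> rw [h5] <;> linarith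

theorem ae_stays_zero (h : IsSignLoop P δ C y g d) :
    ∀ᵐ ω ∂P, ∀ s, 0 ≤ s → y s ω = 0 → ∀ t, s ≤ t → y t ω = 0 := by
  filter_upwards [h.ae_antitone] with ω h1 s hs h0 t hst
  have := h1 s t hs hst
  rw [h0, abs_zero] at this
  exact abs_nonpos_iff.1 this

/-- A path with finite time off zero must hit zero, and zero is absorbing; the path is eventually
constant. -/
theorem ae_tendsto_zero (h : IsSignLoop P δ C y g d) :
    ∀ᵐ ω ∂P, Tendsto (fun t => y t ω) atTop (𝓝 0) := by
  filter_upwards [h.ae_stays_zero, h.ae_measure_offZero_lt_top] with ω h1 h2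
  obtain ⟨s, hs, h0⟩ : ∃ s, 0 < s ∧ y s ω = 0 := by
    by_contra! hcon
    have : Set.Ioi (0 : ℝ) ⊆ {t | 0 < t ∧ y t ω ≠ 0} := fun t ht => ⟨ht, hcon t ht⟩
    have := measure_mono (μ := volume) this
    rw [Real.volume_Ioi, top_le_iff] at this
    exact h2.ne this
  refine tendsto_const_nhds.congr' ?_
  filter_upwards [eventually_ge_atTop s] with t hst using (h1 s hs.le h0 t hst).symm

end IsSignLoop
end DynTU

/-! ### Conditional expectations given the state -/

namespace DynTU

section ConditionalVelocity

variable {Ω : Type*} [mΩ : MeasurableSpace Ω] {P : Measure Ω}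
  {ι : Type*} [Fintype ι] {δ C : ℝ} {X W D : Ω → ι → ℝ}

/-- Given the state, the expected value of `xᵀ ẋ` under the sign feedback is `-δ ‖x‖₁`, since the
disturbance is centred and independent of the state. -/
theorem condExp_dotProduct_velocity [IsProbabilityMeasure P] (hX : Measurable X) (hD : Measurable D)
    (hXD : IndepFun X D P) (hD0 : ∀ i, ∫ ω, D ω i ∂P = 0)
    (hXi : ∀ i, Integrable (fun ω => X ω i) P) (hDC : ∀ ω i, |D ω i| ≤ C)
    (hW : ∀ᵐ ω ∂P, ∀ i, X ω i ≠ 0 → W ω i = -δ * Real.sign (X ω i) - D ω i) :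
    Integrable (fun ω => X ω ⬝ᵥ W ω) P ∧
    P[fun ω => X ω ⬝ᵥ W ω | MeasurableSpace.comap X inferInstance] =ᵐ[P]
      fun ω => -δ * ∑ i, |X ω i| := by
  have hle : MeasurableSpace.comap X inferInstance ≤ mΩ := hX.comap_le
  have hDle : MeasurableSpace.comap D inferInstance ≤ mΩ := hD.comap_le
  have hXm : ∀ i, Measurable[MeasurableSpace.comap X inferInstance] fun ω => X ω i :=
    fun i => (measurable_pi_apply i).comp (comap_measurable X)
  have hDi : ∀ i, Integrable (fun ω => D ω i) P := fun i =>
    Integrable.of_bound ((measurable_pi_apply i).comp hD).aestronglyMeasurable C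
      (ae_of_all _ fun ω => hDC ω i)
  have hXDi : ∀ i, Integrable ((fun ω => X ω i) * fun ω => D ω i) P := fun i =>
    (hXi i).mul_bdd (c := C) ((measurable_pi_apply i).comp hD).aestronglyMeasurable
      (ae_of_all _ fun ω => hDC ω i)
  have hAi : Integrable (fun ω => -δ * ∑ i, |X ω i|) P :=
    (integrable_finsetSum _ fun i _ => (hXi i).abs).const_mul _
  have hSi : Integrable (∑ i, ((fun ω => X ω i) * fun ω => D ω i)) P :=
    integrable_finsetSum' _ fun i _ => hXDi i
  have heq : (fun ω => X ω ⬝ᵥ W ω) =ᵐ[P]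
      (fun ω => -δ * ∑ i, |X ω i|) - ∑ i, ((fun ω => X ω i) * fun ω => D ω i) := by
    filter_upwards [hW] with ω h
    simp only [dotProduct, Pi.sub_apply, Finset.sum_apply, Pi.mul_apply]
    rw [Finset.mul_sum, ← Finset.sum_sub_distrib]
    refine Finset.sum_congr rfl fun i _ => ?_
    by_cases h0 : X ω i = 0
    · simp [h0]
    · rw [h i h0]
      have habs : X ω i * Real.sign (X ω i) = |X ω i| := by
        rcases lt_or_gt_of_ne h0 with h1 | h1
        · rw [Real.sign_of_neg h1, abs_of_neg h1]; ring
        · rw [Real.sign_of_pos h1, abs_of_pos h1]; ring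
      linear_combination (-δ) * habs
  refine ⟨(hAi.sub hSi).congr heq.symm, ?_⟩
  have hA : P[fun ω => -δ * ∑ i, |X ω i| | MeasurableSpace.comap X inferInstance] =
      fun ω => -δ * ∑ i, |X ω i| := by
    refine condExp_of_stronglyMeasurable hle (Measurable.stronglyMeasurable ?_) hAi
    exact (Finset.measurable_fun_sum _ fun i _ => continuous_abs.measurable.comp (hXm i)).const_mul _
  have hS0 : ∀ᵐ ω ∂P, ∀ i, (P[(fun ω => X ω i) * fun ω => D ω i |
      MeasurableSpace.comap X inferInstance]) ω = 0 := by
    refine ae_all_iff.2 fun i => ?_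
    have hind : P[fun ω => D ω i | MeasurableSpace.comap X inferInstance] =ᵐ[P]
        fun _ => ∫ ω, D ω i ∂P :=
      condExp_indep_eq hDle hle
        ((measurable_pi_apply i).comp (comap_measurable D)).stronglyMeasurable hXD.symm
    -- The factor `X i` is known given `X` and is pulled out; what remains is the mean of `D i`.
    filter_upwards [hind, condExp_mul_of_stronglyMeasurable_left (hXm i).stronglyMeasurable
      (hXDi i) (hDi i)] with ω h1 h2
    rw [h2, Pi.mul_apply, h1, hD0, mul_zero]
  filter_upwards [condExp_congr_ae (m := MeasurableSpace.comap X inferInstance) heq,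
    condExp_sub hAi hSi (MeasurableSpace.comap X inferInstance),
    condExp_finsetSum (s := Finset.univ) (fun i _ => hXDi i)
      (MeasurableSpace.comap X inferInstance), hS0] with ω h1 h2 h3 h4
  rw [h1, h2, Pi.sub_apply, h3, hA, Finset.sum_apply]
  simp [h4]

/-- If the velocity vanishes on `{x = 0}`, so does its conditional expectation given `x`. -/
theorem condExp_eq_zero_of_eq_zero (hWi : Integrable W P)
    (hW : ∀ᵐ ω ∂P, X ω = 0 → W ω = 0) :
    ∀ᵐ ω ∂P, X ω = 0 → (P[W | MeasurableSpace.comap X inferInstance]) ω = 0 := by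
  have hs : MeasurableSet[MeasurableSpace.comap X inferInstance] (X ⁻¹' {0}) :=
    ⟨{0}, measurableSet_singleton 0, rfl⟩
  have h0 : (X ⁻¹' {0}).indicator W =ᵐ[P] 0 := by
    filter_upwards [hW] with ω h
    by_cases hω : X ω = 0
    · simp [hω, h hω]
    · simp [hω]
  filter_upwards [condExp_indicator hWi hs,
    condExp_congr_ae (m := MeasurableSpace.comap X inferInstance) h0] with ω h1 h2 hω
  rw [h2, condExp_zero] at h1
  rw [Set.indicator_of_mem (show ω ∈ X ⁻¹' {0} from hω)] at h1
  exact h1.symm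

end ConditionalVelocity

/-! ### Reduction of the closed loop to scalar loops -/

section ClosedLoop

variable {Ω : Type*} [MeasurableSpace Ω] {P : Measure Ω} {n : ℕ}
  {unom : ControlIdx n → ℝ} {δ : ℝ} {Bd : Matrix (ControlIdx n) (Coalition n) ℝ}
  {v : ℝ → Ω → Coalition n → ℝ} {u : ℝ → Ω → ControlIdx n → ℝ} {x : ℝ → Ω → Coalition n → ℝ}
  {vnom : Coalition n → ℝ}

/-- The velocity `B u - v` of the closed loop. -/
noncomputable def velocity (u : ℝ → Ω → ControlIdx n → ℝ) (v : ℝ → Ω → Coalition n → ℝ) (t : ℝ) (ω : Ω) :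
    Coalition n → ℝ :=
  flowMatrix n *ᵥ u t ω - v t ω

/-- The state obtained by integrating the velocity, a jointly measurable version of `x`. -/
noncomputable def integratedState (u : ℝ → Ω → ControlIdx n → ℝ) (v x : ℝ → Ω → Coalition n → ℝ) (t : ℝ)
    (ω : Ω) (i : Coalition n) : ℝ :=
  x 0 ω i + ∫ s, (Set.Ioc 0 t).indicator (fun s => velocity u v s ω i) s

theorem measurable_velocity (hu : Measurable (Function.uncurry u))
    (hv : Measurable (Function.uncurry v)) : Measurable (Function.uncurry (velocity u v)) := by
  have : Measurable fun c : ControlIdx n → ℝ => flowMatrix n *ᵥ c :=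
    (Continuous.matrix_mulVec continuous_const continuous_id).measurable
  exact (this.comp hu).sub hv

/-- The state is only assumed measurable at each fixed time, whereas the Fubini arguments need joint
measurability. This version has it, and almost surely agrees with `x` at all times `t ≥ 0`. -/
theorem measurable_integratedState (hu : Measurable (Function.uncurry u))
    (hv : Measurable (Function.uncurry v)) (hx : Measurable (x 0)) (i : Coalition n) :
    Measurable (Function.uncurry fun t ω => integratedState u v x t ω i) := by
  -- Putting the moving endpoint into an indicator makes this a parametric integral over a fixed
  -- domain.
  have h1 : Measurable fun q : (ℝ × Ω) × ℝ => (Set.Ioc 0 q.1.1).indicator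
      (fun s => velocity u v s q.1.2 i) q.2 := by
    have hset : MeasurableSet {q : (ℝ × Ω) × ℝ | q.2 ∈ Set.Ioc 0 q.1.1} :=
      (measurableSet_lt measurable_const measurable_snd).inter
        (measurableSet_le measurable_snd measurable_fst.fst)
    have hvel : Measurable fun q : (ℝ × Ω) × ℝ => velocity u v q.2 q.1.2 i :=
      (measurable_pi_apply i).comp ((measurable_velocity hu hv).comp
        (measurable_snd.prodMk measurable_fst.snd))
    exact hvel.indicator hset
  exact (((measurable_pi_apply i).comp hx).comp measurable_snd).add
    h1.stronglyMeasurable.integral_prod_right'.measurable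

/-- This is the decoupling: `B B† = I` leaves each coordinate driven by its own sign alone. -/
theorem flowMatrix_mulVec_signControl (hBd : flowMatrix n * Bd = 1)
    (hnom : flowMatrix n *ᵥ unom = vnom) (σ : Coalition n → ℝ) :
    flowMatrix n *ᵥ signControl unom δ Bd σ = vnom - δ • σ := by
  rw [signControl, Matrix.mulVec_sub, hnom, Matrix.mulVec_smul, Matrix.mulVec_mulVec, hBd,
    Matrix.one_mulVec]

theorem IsClosedLoop.velocity_eq (hx : IsClosedLoop P unom δ Bd v u x)
    (hBd : flowMatrix n * Bd = 1) (hnom : flowMatrix n *ᵥ unom = vnom) :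
    ∀ᵐ ω ∂P, ∀ᵐ t ∂(volume.restrict (Set.Ici (0 : ℝ))), ∃ σ ∈ filippovSgn (x t ω),
      ∀ i, velocity u v t ω i = -δ * σ i - (v t ω i - vnom i) := by
  filter_upwards [hx.control_mem] with ω h
  filter_upwards [h] with t ⟨σ, hσ, hu⟩
  refine ⟨σ, hσ, fun i => ?_⟩
  rw [velocity, ← hu, flowMatrix_mulVec_signControl hBd hnom]
  simp only [Pi.sub_apply, Pi.smul_apply, smul_eq_mul]
  ring

theorem abs_le_one_of_mem_filippovSgn {ι : Type*} {y σ : ι → ℝ} (h : σ ∈ filippovSgn y) (i : ι) :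
    |σ i| ≤ 1 := by
  by_cases hy : y i = 0
  · exact abs_le.2 ((h i).2 hy)
  · rw [(h i).1 hy]; exact abs_sign_le_one _

theorem IsClosedLoop.abs_velocity_le (hx : IsClosedLoop P unom δ Bd v u x) (hδ : 0 < δ)
    (hBd : flowMatrix n * Bd = 1) (hnom : flowMatrix n *ᵥ unom = vnom) {C : ℝ}
    (hC : ∀ t, 0 ≤ t → ∀ ω i, |v t ω i - vnom i| ≤ C) :
    ∀ᵐ ω ∂P, ∀ᵐ t ∂(volume.restrict (Set.Ici (0 : ℝ))), ∀ i, |velocity u v t ω i| ≤ δ + C := by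
  filter_upwards [hx.velocity_eq hBd hnom] with ω h
  filter_upwards [h, ae_restrict_mem measurableSet_Ici] with t ⟨σ, hσ, hw⟩ ht i
  have h1 := abs_le_one_of_mem_filippovSgn hσ i
  have h2 := hC t ht ω i
  rw [hw]
  calc |-δ * σ i - (v t ω i - vnom i)| ≤ |-δ * σ i| + |v t ω i - vnom i| := abs_sub _ _
    _ = δ * |σ i| + |v t ω i - vnom i| := by rw [abs_mul, abs_neg, abs_of_pos hδ]
    _ ≤ δ + C := by nlinarith

theorem IsClosedLoop.state_apply_eq (hx : IsClosedLoop P unom δ Bd v u x) (hδ : 0 < δ)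
    (hBd : flowMatrix n * Bd = 1) (hnom : flowMatrix n *ᵥ unom = vnom) {C : ℝ}
    (hv : Measurable (Function.uncurry v)) (hC : ∀ t, 0 ≤ t → ∀ ω i, |v t ω i - vnom i| ≤ C) :
    ∀ᵐ ω ∂P, ∀ t, 0 ≤ t → ∀ i, x t ω i = x 0 ω i + ∫ s in (0 : ℝ)..t, velocity u v s ω i := by
  filter_upwards [hx.state_eq, hx.abs_velocity_le hδ hBd hnom hC] with ω h1 h2 t ht i
  have hm : ∀ i, Measurable fun s => velocity u v s ω i := fun i =>
    (measurable_pi_apply i).comp (measurable_velocity hx.measurable_control hv).of_uncurry_right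
  have hint : ∀ i, IntervalIntegrable (fun s => velocity u v s ω i) volume 0 t := fun i =>
    intervalIntegrable_of_ae_abs_le (hm i) (h2.mono fun s hs => hs i) le_rfl ht
  rw [h1 t ht, Pi.add_apply, intervalIntegral.integral_of_le ht,
    intervalIntegral.integral_of_le ht]
  congr 1
  exact eval_integral (f := fun s => velocity u v s ω) (fun i => (intervalIntegrable_iff_integrableOn_Ioc_of_le ht).1 (hint i)) i

theorem IsClosedLoop.state_eq_integratedState (hx : IsClosedLoop P unom δ Bd v u x) (hδ : 0 < δ)
    (hBd : flowMatrix n * Bd = 1) (hnom : flowMatrix n *ᵥ unom = vnom) {C : ℝ}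
    (hv : Measurable (Function.uncurry v)) (hC : ∀ t, 0 ≤ t → ∀ ω i, |v t ω i - vnom i| ≤ C) :
    ∀ᵐ ω ∂P, ∀ t, 0 ≤ t → ∀ i, integratedState u v x t ω i = x t ω i := by
  filter_upwards [hx.state_apply_eq hδ hBd hnom hv hC] with ω h t ht i
  rw [h t ht i, integratedState, integral_indicator measurableSet_Ioc,
    intervalIntegral.integral_of_le ht]

theorem IsClosedLoop.isSignLoop [IsProbabilityMeasure P] (hx : IsClosedLoop P unom δ Bd v u x)
    (hδ : 0 < δ) (hBd : flowMatrix n * Bd = 1) (hnom : flowMatrix n *ᵥ unom = vnom) {C : ℝ}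
    {V : Set (Coalition n → ℝ)} {law : Measure (Coalition n → ℝ)}
    (hv : IsBoundedMeanErgodic P V law v vnom)
    (hC : ∀ t, 0 ≤ t → ∀ ω i, |v t ω i - vnom i| ≤ C) (hx0 : Integrable (x 0) P)
    (hindep : ∀ t, 0 ≤ t → IndepFun (x t) (fun ω => v t ω - vnom) P) (i : Coalition n) :
    IsSignLoop P δ C (fun t ω => integratedState u v x t ω i) (fun t ω => velocity u v t ω i)
      (fun t ω => v t ω i - vnom i) where
  gain_pos := hδ
  meas_state := measurable_integratedState hx.measurable_control hv.measurable
    (hx.measurable_state 0 le_rfl) i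
  meas_velocity := (measurable_pi_apply i).comp
    (measurable_velocity hx.measurable_control hv.measurable)
  meas_disturbance := ((measurable_pi_apply i).comp hv.measurable).sub_const _
  eq_integral := by
    filter_upwards [hx.state_eq_integratedState hδ hBd hnom hv.measurable hC,
      hx.state_apply_eq hδ hBd hnom hv.measurable hC] with ω h1 h2 t ht
    rw [h1 t ht, h1 0 le_rfl, h2 t ht]
  abs_disturbance_le t ht ω := hC t ht ω i
  velocity_eq := by
    filter_upwards [hx.state_eq_integratedState hδ hBd hnom hv.measurable hC,
      hx.velocity_eq hBd hnom] with ω h1 h2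
    filter_upwards [h2, ae_restrict_mem measurableSet_Ici] with t ⟨σ, hσ, hw⟩ ht
    rw [h1 t ht]
    exact ⟨σ i, (hσ i).1, (hσ i).2, hw i⟩
  integrable_zero := by
    simpa [integratedState] using hx0.eval i
  indep t ht := by
    have h1 : IndepFun (fun ω => x t ω i) (fun ω => v t ω i - vnom i) P :=
      (hindep t ht).comp (measurable_pi_apply i) (measurable_pi_apply i)
    -- Independence is assumed for `x` itself; it passes to the almost surely equal integrated
    -- version.
    refine h1.congr ?_ (ae_eq_refl _)
    filter_upwards [hx.state_eq_integratedState hδ hBd hnom hv.measurable hC] with ω h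
    exact (h t ht i).symm
  mean_zero t ht := by
    have hm : ∀ i, Integrable (fun ω => v t ω i) P := fun i => by
      have h1 : Integrable (fun ω => v t ω i - vnom i) P := Integrable.of_bound
        (((measurable_pi_apply i).comp hv.measurable.of_uncurry_left).sub_const
          _).aestronglyMeasurable C (ae_of_all _ fun ω => hC t ht ω i)
      simpa only [Pi.add_def, sub_add_cancel] using h1.add (integrable_const (vnom i))
    rw [integral_sub (hm i) (integrable_const _), ← eval_integral hm, hv.mean t ht]
    simp
  map_eq s t hs ht := by
    have h0 : Measurable fun c : Coalition n → ℝ => c i - vnom i :=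
      (measurable_pi_apply i).sub_const _
    have h1 := Measure.map_map (μ := P) h0 (hv.measurable.of_uncurry_left (x := s))
    have h2 := Measure.map_map (μ := P) h0 (hv.measurable.of_uncurry_left (x := t))
    have h3 := (hv.map_eq s hs).trans (hv.map_eq t ht).symm
    exact h1.symm.trans ((congrArg (Measure.map fun c => c i - vnom i) h3).trans h2)

end ClosedLoop
end DynTU

/-! ### Assembly of the coordinates -/

theorem theorem4 {Ω : Type*} [MeasurableSpace Ω] (P : Measure Ω) [IsProbabilityMeasure P]
    (n : ℕ) (amin amax : Fin n → ℝ)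
    (V : Set (DynTU.Coalition n → ℝ)) (law : Measure (DynTU.Coalition n → ℝ))
    (v : ℝ → Ω → DynTU.Coalition n → ℝ) (vnom : DynTU.Coalition n → ℝ)
    (hv : DynTU.IsBoundedMeanErgodic P V law v vnom)
    (unom : DynTU.ControlIdx n → ℝ) (δ : ℝ)
    (Bd : Matrix (DynTU.ControlIdx n) (DynTU.Coalition n) ℝ)
    (hctrl : DynTU.IsSignController amin amax vnom unom δ Bd)
    (u : ℝ → Ω → DynTU.ControlIdx n → ℝ) (x : ℝ → Ω → DynTU.Coalition n → ℝ)
    (hx : DynTU.IsClosedLoop P unom δ Bd v u x)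
    (hx0 : MemLp (x 0) 2 P)
    (hindep : ∀ t, 0 ≤ t → IndepFun (x t) (fun ω => v t ω - vnom) P) :
    DynTU.OriginAttainable P x := by

  obtain ⟨hδ, hBd, -, hnom, -⟩ := hctrl
  obtain ⟨K, hK⟩ := hv.bounded.exists_norm_le
  have hC : ∀ t, 0 ≤ t → ∀ ω i, |v t ω i - vnom i| ≤ K + ‖vnom‖ := fun t ht ω i =>
    (norm_le_pi_norm (v t ω - vnom) i).trans
      ((norm_sub_le _ _).trans (by gcongr; exact hK _ (hv.mem t ht ω)))
  have hx0i : Integrable (x 0) P := hx0.integrable (by norm_num)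
  have hloop := hx.isSignLoop hδ hBd hnom hv hC hx0i hindep
  have hst := hx.state_eq_integratedState hδ hBd hnom hv.measurable hC
  have hwm := DynTU.measurable_velocity hx.measurable_control hv.measurable
  have hpath : ∀ᵐ ω ∂P, ∀ i, DynTU.IsIntegralPath (fun t => x t ω i)
      (fun t => DynTU.velocity u v t ω i) (δ + (K + ‖vnom‖)) := by
    filter_upwards [hst, ae_all_iff.2 fun i => (hloop i).isIntegralPath] with ω h1 h2 i
    refine ⟨(h2 i).meas, (h2 i).bound, fun t ht => ?_⟩
    rw [← h1 t ht i, ← h1 0 le_rfl i]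
    exact (h2 i).eq_integral t ht
  refine ⟨⟨DynTU.velocity u v, hwm, ?_, ?_⟩, ?_, ?_⟩
  · filter_upwards [hpath] with ω h
    filter_upwards [ae_all_iff.2 fun i => (h i).ae_hasDerivAt] with t ht
    exact hasDerivAt_pi.2 ht
  · have hvel := ae_all_iff.2 fun i => (hloop i).velocity_swap
    filter_upwards [hvel, ae_restrict_mem measurableSet_Ici] with t h1 ht
    have hxm := hx.measurable_state t ht
    have hW : ∀ᵐ ω ∂P, ∀ i,
        (x t ω i ≠ 0 → DynTU.velocity u v t ω i =
          -δ * Real.sign (x t ω i) - (v t ω i - vnom i)) ∧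
        (x t ω i = 0 → DynTU.velocity u v t ω i = 0) := by
      filter_upwards [hst, ae_all_iff.2 h1] with ω h2 h3 i
      have := h3 i
      rw [h2 t ht i] at this
      exact ⟨this.1, fun h => (this.2 h).1⟩
    have hK0 : 0 ≤ K + ‖vnom‖ := by
      obtain ⟨ω⟩ := nonempty_of_isProbabilityMeasure P
      have := (norm_nonneg _).trans (hK _ (hv.mem t ht ω))
      positivity
    have hWi : Integrable (DynTU.velocity u v t) P := by
      refine Integrable.of_bound hwm.of_uncurry_left.aestronglyMeasurable
        (δ + (K + ‖vnom‖)) ?_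
      filter_upwards [hW] with ω h2
      refine (pi_norm_le_iff_of_nonneg (by positivity)).2 fun i => ?_
      by_cases h0 : x t ω i = 0
      · rw [(h2 i).2 h0, norm_zero]; positivity
      · rw [(h2 i).1 h0, Real.norm_eq_abs]
        refine (abs_sub _ _).trans (add_le_add ?_ (hC t ht ω i))
        rw [abs_mul, abs_neg, abs_of_pos hδ]
        exact mul_le_of_le_one_right hδ.le (DynTU.abs_sign_le_one _)
    -- The increment from time `0` is bounded by the velocity bound times `t`, so integrability is
    -- inherited from `x 0`.
    have hXi : ∀ i, Integrable (fun ω => x t ω i) P := fun i => by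
      have hb : Integrable (fun ω => x t ω i - x 0 ω i) P := by
        refine Integrable.of_bound (((measurable_pi_apply i).comp hxm).sub
          ((measurable_pi_apply i).comp (hx.measurable_state 0 le_rfl))).aestronglyMeasurable
          ((δ + (K + ‖vnom‖)) * |t - 0|) ?_
        filter_upwards [hpath] with ω h using (h i).abs_sub_le le_rfl ht
      simpa only [Pi.add_def, sub_add_cancel] using hb.add (hx0i.eval i)
    have hmain := DynTU.condExp_dotProduct_velocity (δ := δ) hxm
      (hv.measurable.of_uncurry_left.sub_const vnom) (hindep t ht)
      (fun i => (hloop i).mean_zero t ht) hXi (hC t ht) (hW.mono fun ω h i => (h i).1)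
    refine ⟨hmain.1, hWi, ?_⟩
    filter_upwards [hmain.2, DynTU.condExp_eq_zero_of_eq_zero hWi
      (hW.mono fun ω h h0 => funext fun i => (h i).2 (congrFun h0 i))] with ω h2 h3
    refine ⟨fun hne => ?_, h3⟩
    rw [h2]
    obtain ⟨i, hi⟩ := Function.ne_iff.1 hne
    have : 0 < ∑ i, |x t ω i| :=
      Finset.sum_pos' (fun i _ => abs_nonneg _) ⟨i, Finset.mem_univ _, abs_pos.2 hi⟩
    nlinarith
  · filter_upwards [hst, ae_all_iff.2 fun i => (hloop i).ae_tendsto_zero] with ω h1 h2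
    refine tendsto_pi_nhds.2 fun i => (h2 i).congr' ?_
    filter_upwards [eventually_ge_atTop 0] with t ht using h1 t ht i
  · filter_upwards [hst, ae_all_iff.2 fun i => (hloop i).ae_stays_zero]
      with ω h1 h2 s hs h0 t hst'
    funext i
    have := h2 i s hs ((h1 s hs i).trans (congrFun h0 i)) t hst'
    exact (h1 t (hs.trans hst') i).symm.trans this
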